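/- Let $K$ be a field, let $m,n$ be positive integers, let $X=(x_{ij})$ be the $m\times n$ matrix of indeterminates over $K$, and let $I_2(X)$ be the ideal of $K[x_{ij} : 1\le i\le m,\ 1\le j\le n]$ generated by all $2$-minors of $X$. For an integer $s$ with $2\le s\le \min(m,n)$ and sequences $I=(i_1,\dots,i_s)$ of distinct elements of $\{1,\dots,m\}$ and $J=(j_1,\dots,j_s)$ of distinct elements of $\{1,\dots,n\}$, put $$F_{I,J}=x_{i_1j_1}x_{i_2j_2}\cdots x_{i_sj_s}-x_{i_1j_2}x_{i_2j_3}\cdots x_{i_{s-1}j_s}x_{i_sj_1}.$$ Then the set of all binomials $F_{I,J}$ (over all such $s$, $I$, $J$) is a universal Gröbner basis of $I_2(X)$. That is, it is a finite set of nonzero elements of $I_2(X)$ and, for every term order on the monomials of $K[x_{ij}]$, the initial monomials of the $F_{I,J}$ generate the initial ideal $\operatorname{in}(I_2(X))=(\operatorname{in}(f) : f\in I_2(X)\setminus\{0\})$. -/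

import Mathlib

universe u v

noncomputable section

namespace DetGroebner

/-- The initial monomial `in(f)` of `f` with respect to the term order `ord`: the largest monomial
occurring in `f`, with coefficient `1` (meaningful for `f ≠ 0`). -/
def initialMonomial {σ K : Type*} [CommSemiring K] (ord : MonomialOrder σ)
    (f : MvPolynomial σ K) : MvPolynomial σ K :=
  MvPolynomial.monomial (ord.degree f) 1

/-- The initial ideal `in(I)`, generated by the initial monomials of the nonzero elements
of `I`. -/
def initialIdeal {σ K : Type*} [Field K] (ord : MonomialOrder σ)
    (I : Ideal (MvPolynomial σ K)) : Ideal (MvPolynomial σ K) :=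
  Ideal.span {g | ∃ f ∈ I, f ≠ 0 ∧ initialMonomial ord f = g}

/-- `G` is a Gröbner basis of `I` with respect to `ord`: a finite set of nonzero elements of `I`
whose initial monomials generate the initial ideal of `I`. -/
structure IsGroebnerBasis {σ K : Type*} [Field K] (ord : MonomialOrder σ)
    (G : Set (MvPolynomial σ K)) (I : Ideal (MvPolynomial σ K)) : Prop where
  finite : G.Finite
  subset : ∀ g ∈ G, g ∈ I
  ne_zero : ∀ g ∈ G, g ≠ 0
  span_eq : Ideal.span (initialMonomial ord '' G) = initialIdeal ord I

/-- `G` is a universal Gröbner basis of `I`: a Gröbner basis with respect to every term order.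
(A term order is a structure on the type `σ →₀ ℕ` of exponents, so letting the carrier of the
order range over the universe of `σ` covers all term orders.) -/
def IsUniversalGroebnerBasis {σ : Type u} {K : Type v} [Field K]
    (G : Set (MvPolynomial σ K)) (I : Ideal (MvPolynomial σ K)) : Prop :=
  ∀ ord : MonomialOrder.{u, u} σ, IsGroebnerBasis ord G I

/-- The determinantal ideal `I_t(A)`, generated by all `t`-minors of the `m × n` matrix `A`. -/
def determinantalIdeal {R : Type*} [CommRing R] {m n : ℕ} (t : ℕ)
    (A : Matrix (Fin m) (Fin n) R) : Ideal R :=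
  Ideal.span {d | ∃ (r : Fin t ↪o Fin m) (c : Fin t ↪o Fin n), d = (A.submatrix r c).det}

/-- The binomial `F_{I,J} = x_{i₁j₁} x_{i₂j₂} ⋯ x_{iₛjₛ} - x_{i₁j₂} x_{i₂j₃} ⋯ x_{iₛj₁}` attached to
sequences `I = i₁,…,iₛ` and `J = j₁,…,jₛ`. Here `finRotate s` is the cyclic shift `k ↦ k + 1`. -/
def cycleBinomial (K : Type*) [Field K] {m n s : ℕ} (I : Fin s → Fin m) (J : Fin s → Fin n) :
    MvPolynomial (Fin m × Fin n) K :=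
  ∏ k, MvPolynomial.X (I k, J k) - ∏ k, MvPolynomial.X (I k, J (finRotate s k))

/-- The set of all `F_{I,J}`, where `I` and `J` are sequences of the same length `s ≥ 2`, each with
distinct entries (so `s ≤ m` and `s ≤ n`). -/
def cycleBinomials (K : Type*) [Field K] (m n : ℕ) : Set (MvPolynomial (Fin m × Fin n) K) :=
  {F | ∃ (s : ℕ) (I : Fin s → Fin m) (J : Fin s → Fin n),
    2 ≤ s ∧ Function.Injective I ∧ Function.Injective J ∧ F = cycleBinomial K I J}

end DetGroebner

end

namespace DetGroebner

open MvPolynomial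

open scoped MonomialOrder

/-! The map `x_ij ↦ y_i z_j` kills the 2-minors and sends `x^a` to the monomial of the row and
column sums of `a` (`margins`). So the initial exponent `a` of a nonzero `f` in the ideal must
cancel against some `b ≺ a` with equal margins. Then `a - b` has zero row and column sums, hence
contains an alternating cycle: a binomial `x^u - x^v` among the `F_{I,J}` with `u ≤ a`, `v ≤ b`. If
`v ≺ u`, its initial monomial divides `x^a`; otherwise remove `u` from `a` and `v` from `b` and
induct on degree (`exists_cycle_lt`). No S-pairs are needed. -/

/-- Alternating cycles: if every `P`-edge can be continued by an `N`-edge in the same row and every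
`N`-edge by a `P`-edge in the same column, there is a simple closed alternating walk. -/
theorem exists_alternating_cycle {α β : Type*} [Finite α] {P N : α → β → Prop}
    (hne : ∃ i j, P i j) (hrow : ∀ i j, P i j → ∃ j', N i j') (hcol : ∀ i j, N i j → ∃ i', P i' j)
    (hdisj : ∀ i j, P i j → ¬ N i j) :
    ∃ (s : ℕ) (I : Fin s → α) (J : Fin s → β), 2 ≤ s ∧ Function.Injective I ∧
      Function.Injective J ∧ (∀ k, P (I k) (J k)) ∧ ∀ k, N (I k) (J (finRotate s k)) := by
  let D := {i : α // ∃ j, P i j}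
  let E := {j : β // ∃ i, N i j}
  have h1 : ∀ d : D, ∃ e : E, N d.1 e.1 := fun ⟨i, j, h⟩ =>
    let ⟨j', h'⟩ := hrow i j h
    ⟨⟨j', i, h'⟩, h'⟩
  have h2 : ∀ e : E, ∃ d : D, P d.1 e.1 := fun ⟨j, i, h⟩ =>
    let ⟨i', h'⟩ := hcol i j h
    ⟨⟨i', j, h'⟩, h'⟩
  choose ν hν using h1
  choose ρ hρ using h2
  -- Follow an `N`-edge, then a `P`-edge. Rows are finite, so an orbit has a periodic point; its
  -- minimal period makes `I` injective.
  let f : D → D := fun d => ρ (ν d)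
  obtain ⟨i₀, j₀, h₀⟩ := hne
  obtain ⟨x, hx⟩ : ∃ x, x ∈ Function.periodicPts f := by
    obtain ⟨k, l, hkl, he⟩ := Finite.exists_ne_map_eq_of_infinite
      (fun k : ℕ => f^[k] (⟨i₀, j₀, h₀⟩ : D))
    wlog hlt : k < l generalizing k l
    · exact this l k hkl.symm he.symm (by omega)
    refine ⟨f^[k] ⟨i₀, j₀, h₀⟩, l - k, by omega, ?_⟩
    change f^[l - k] (f^[k] _) = _
    rw [← Function.iterate_add_apply, Nat.sub_add_cancel hlt.le]
    exact he.symm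
  set s := Function.minimalPeriod f x with hs
  have hpos : 0 < s := Function.minimalPeriod_pos_of_mem_periodicPts hx
  let I : Fin s → D := fun k => f^[k.1] x
  have hI : Function.Injective I := fun k l h =>
    Fin.ext ((Function.iterate_eq_iterate_iff_of_lt_minimalPeriod k.2 l.2).1 h)
  have hrot : ∀ k, I (finRotate s k) = f (I k) := by
    intro k
    have hv : (finRotate s k).1 = (k.1 + 1) % s := by
      obtain ⟨t, ht⟩ : ∃ t, s = t + 1 := ⟨s - 1, by omega⟩
      clear_value s
      subst ht
      rw [finRotate_apply, Fin.val_add]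
      simp
    change f^[(finRotate s k).1] x = f (f^[k.1] x)
    rw [hv, ← Function.iterate_succ_apply' f]
    exact Function.iterate_mod_minimalPeriod_eq
  -- `J k` is the column through which the walk enters row `I k`; hence the inverse shift.
  let J : Fin s → E := fun k => ν (I ((finRotate s).symm k))
  have hJ : ∀ k, ρ (J k) = I k := by
    intro k
    have := hrot ((finRotate s).symm k)
    rw [Equiv.apply_symm_apply] at this
    exact this.symm
  have hP : ∀ k, P (I k).1 (J k).1 := fun k => by
    have := hρ (J k)
    rwa [hJ] at this
  have hN : ∀ k, N (I k).1 (J (finRotate s k)).1 := fun k => by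
    have := hν (I k)
    simpa only [J, Equiv.symm_apply_apply] using this
  refine ⟨s, fun k => (I k).1, fun k => (J k).1, ?_, fun k l h => hI (Subtype.ext h),
    fun k l h => hI ?_, hP, hN⟩
  -- With `s = 1` the rotation is trivial, and one edge would lie in both `P` and `N`.
  · by_contra hlt
    have : Subsingleton (Fin s) := Fin.subsingleton_iff_le_one.2 (by omega)
    have h := hN ⟨0, hpos⟩
    rw [Subsingleton.elim (finRotate s ⟨0, hpos⟩) ⟨0, hpos⟩] at h
    exact hdisj _ _ (hP _) h
  · rw [← hJ k, ← hJ l, Subtype.ext h]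

/-! ### Exponents with equal row and column sums -/

section Exponents

variable {m n : ℕ}

/-- The exponent of the monomial `∏ k, x (I k, J k)`. -/
noncomputable def pathExponent {s : ℕ} (I : Fin s → Fin m) (J : Fin s → Fin n) : Fin m × Fin n →₀ ℕ :=
  ∑ k, Finsupp.single (I k, J k) 1

theorem monomial_pathExponent (K : Type*) [Field K] {s : ℕ} (I : Fin s → Fin m)
    (J : Fin s → Fin n) :
    monomial (pathExponent I J) (1 : K) = ∏ k, X (I k, J k) :=
  monomial_sum_one _ _

theorem cycleBinomial_eq (K : Type*) [Field K] {s : ℕ} (I : Fin s → Fin m) (J : Fin s → Fin n) :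
    cycleBinomial K I J = monomial (pathExponent I J) 1 -
      monomial (pathExponent I fun k => J (finRotate s k)) 1 := by
  rw [monomial_pathExponent, monomial_pathExponent, cycleBinomial]

theorem pathExponent_apply {s : ℕ} (I : Fin s → Fin m) (J : Fin s → Fin n) (i : Fin m)
    (j : Fin n) : pathExponent I J (i, j) = ∑ k, if I k = i ∧ J k = j then 1 else 0 := by
  simp [pathExponent, Finsupp.finsetSum_apply, Finsupp.single_apply]

/-- Injectivity of `I` makes every entry of the path exponent at most 1. -/
theorem pathExponent_le {s : ℕ} {I : Fin s → Fin m} {J : Fin s → Fin n}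
    (hI : Function.Injective I) {a : Fin m × Fin n →₀ ℕ} (h : ∀ k, 0 < a (I k, J k)) :
    pathExponent I J ≤ a := by
  rintro ⟨i, j⟩
  rw [pathExponent_apply]
  by_cases hk : ∃ k, I k = i ∧ J k = j
  · obtain ⟨k, rfl, rfl⟩ := hk
    rw [Finset.sum_eq_single k (fun l _ hl => if_neg fun h' => hl (hI h'.1)) (by simp)]
    rw [if_pos ⟨rfl, rfl⟩]
    exact h k
  · push Not at hk
    rw [Finset.sum_eq_zero fun k _ => if_neg fun h' => hk k h'.1 h'.2]
    exact Nat.zero_le _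

/-- The row and column sums of an exponent. -/
noncomputable def margins : (Fin m × Fin n →₀ ℕ) →+ (Fin m ⊕ Fin n →₀ ℕ) where
  toFun a := a.mapDomain (fun p => Sum.inl p.1) + a.mapDomain (fun p => Sum.inr p.2)
  map_zero' := by simp
  map_add' a b := by
    rw [Finsupp.mapDomain_add, Finsupp.mapDomain_add]
    abel

theorem margins_single (p : Fin m × Fin n) (c : ℕ) :
    margins (Finsupp.single p c) =
      Finsupp.single (Sum.inl p.1) c + Finsupp.single (Sum.inr p.2) c := by
  simp [margins]

theorem margins_eq_sum (a : Fin m × Fin n →₀ ℕ) :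
    margins a = ∑ i, ∑ j, margins (Finsupp.single (i, j) (a (i, j))) := by
  conv_lhs => rw [← Finsupp.univ_sum_single a]
  rw [map_sum, Fintype.sum_prod_type]

theorem margins_inl (a : Fin m × Fin n →₀ ℕ) (i : Fin m) :
    margins a (Sum.inl i) = ∑ j, a (i, j) := by
  rw [margins_eq_sum]
  simp [margins_single, Finsupp.finsetSum_apply, Finsupp.single_apply]

theorem margins_inr (a : Fin m × Fin n →₀ ℕ) (j : Fin n) :
    margins a (Sum.inr j) = ∑ i, a (i, j) := by
  rw [margins_eq_sum]
  simp [margins_single, Finsupp.finsetSum_apply, Finsupp.single_apply]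

theorem margins_pathExponent_perm {s : ℕ} (I : Fin s → Fin m) (J : Fin s → Fin n)
    (e : Equiv.Perm (Fin s)) :
    margins (pathExponent I fun k => J (e k)) = margins (pathExponent I J) := by
  simp only [pathExponent, map_sum, margins_single, Finset.sum_add_distrib]
  rw [Equiv.sum_comp e fun k => Finsupp.single (Sum.inr (J k)) 1]

theorem exists_lt_of_sum_eq {ι : Type*} [Fintype ι] {f g : ι → ℕ} (h : ∑ i, f i = ∑ i, g i)
    {i : ι} (hi : f i < g i) : ∃ j, g j < f j := by
  by_contra! hle
  exact (Finset.sum_lt_sum (fun j _ => hle j) ⟨i, Finset.mem_univ i, hi⟩).ne h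

/-- Two distinct exponents with equal margins differ along an alternating cycle. -/
theorem exists_cycle_le {a b : Fin m × Fin n →₀ ℕ} (hm : margins a = margins b) (hab : a ≠ b) :
    ∃ (s : ℕ) (I : Fin s → Fin m) (J : Fin s → Fin n), 2 ≤ s ∧ Function.Injective I ∧
      Function.Injective J ∧ pathExponent I J ≤ a ∧
      pathExponent I (fun k => J (finRotate s k)) ≤ b := by
  have hr : ∀ i, ∑ j, a (i, j) = ∑ j, b (i, j) := fun i => by
    rw [← margins_inl, hm, margins_inl]
  have hc : ∀ j, ∑ i, a (i, j) = ∑ i, b (i, j) := fun j => by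
    rw [← margins_inr, hm, margins_inr]
  obtain ⟨s, I, J, hs, hI, hJ, hP, hN⟩ := exists_alternating_cycle
    (P := fun i j => b (i, j) < a (i, j)) (N := fun i j => a (i, j) < b (i, j))
    (by
      obtain ⟨⟨i, j⟩, hij⟩ := DFunLike.ne_iff.1 hab
      rcases hij.lt_or_gt with h | h
      · exact ⟨i, exists_lt_of_sum_eq (hr i) h⟩
      · exact ⟨i, j, h⟩)
    (fun i j h => exists_lt_of_sum_eq (hr i).symm h)
    (fun i j h => exists_lt_of_sum_eq (f := fun i => a (i, j)) (hc j) h)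
    (fun i j h => h.le.not_gt)
  exact ⟨s, I, J, hs, hI, hJ, pathExponent_le hI fun k => (Nat.zero_le _).trans_lt (hP k),
    pathExponent_le hI fun k => (Nat.zero_le _).trans_lt (hN k)⟩

/-- If `b ≺ a` have equal margins, some cycle binomial has its initial exponent below `a`. -/
theorem exists_cycle_lt (ord : MonomialOrder (Fin m × Fin n)) (a b : Fin m × Fin n →₀ ℕ)
    (hm : margins a = margins b) (hlt : b ≺[ord] a) :
    ∃ (s : ℕ) (I : Fin s → Fin m) (J : Fin s → Fin n), 2 ≤ s ∧ Function.Injective I ∧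
      Function.Injective J ∧ pathExponent I J ≤ a ∧
      pathExponent I (fun k => J (finRotate s k)) ≺[ord] pathExponent I J := by
  induction hd : a.degree using Nat.strong_induction_on generalizing a b with
  | _ d ih =>
    obtain ⟨s, I, J, hs, hI, hJ, hu, hv⟩ := exists_cycle_le hm (by rintro rfl; exact hlt.ne rfl)
    rcases lt_or_ge (ord.toSyn (pathExponent I fun k => J (finRotate s k)))
      (ord.toSyn (pathExponent I J)) with h | h
    · exact ⟨s, I, J, hs, hI, hJ, hu, h⟩
    have hperm := margins_pathExponent_perm I J (finRotate s)
    have hdeg : (pathExponent I J).degree = s := by simp [pathExponent]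
    generalize pathExponent I J = u at hu h hperm hdeg
    generalize (pathExponent I fun k => J (finRotate s k)) = v at hv h hperm
    obtain ⟨a', rfl⟩ := exists_add_of_le hu
    obtain ⟨b', rfl⟩ := exists_add_of_le hv
    rw [map_add, map_add, hperm, add_right_inj] at hm
    rw [map_add, map_add] at hlt
    -- Otherwise adding `u ≼ v` and `a' ≼ b'` contradicts `hlt`.
    have hlt' : b' ≺[ord] a' := by
      by_contra! hle
      exact (add_le_add h hle).not_gt hlt
    obtain ⟨s', I', J', hs', hI', hJ', hu', h'⟩ := ih a'.degree
      (by rw [map_add] at hd; omega) a' b' hm hlt' rfl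
    exact ⟨s', I', J', hs', hI', hJ', hu'.trans le_add_self, h'⟩

end Exponents

/-! ### The Segre parametrization -/

section Segre

variable (K : Type*) [Field K] (m n : ℕ)

/-- The parametrization `x_{ij} ↦ y_i z_j` of the rank one matrices. -/
noncomputable def segreMap : MvPolynomial (Fin m × Fin n) K →ₐ[K] MvPolynomial (Fin m ⊕ Fin n) K :=
  aeval fun p => X (Sum.inl p.1) * X (Sum.inr p.2)

variable {K m n}

theorem segreMap_monomial (a : Fin m × Fin n →₀ ℕ) (c : K) :
    segreMap K m n (monomial a c) = monomial (margins a) c := by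
  induction a using Finsupp.induction_linear generalizing c with
  | zero => simp [← C_apply, segreMap]
  | add a b ha hb =>
    have : monomial (a + b) c = monomial a c * monomial b (1 : K) := by simp [monomial_mul]
    rw [this, map_mul, ha, hb, monomial_mul, map_add, mul_one]
  | single p k =>
    rw [margins_single, segreMap, aeval_monomial, Finsupp.prod_single_index (by simp), mul_pow,
      X_pow_eq_monomial, X_pow_eq_monomial, monomial_mul, mul_one]
    simp [algebraMap_eq, C_mul_monomial]

theorem determinantalIdeal_two_le_ker :
    determinantalIdeal 2 (Matrix.mvPolynomialX (Fin m) (Fin n) K) ≤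
      RingHom.ker (segreMap K m n) := by
  rw [determinantalIdeal, Ideal.span_le]
  rintro _ ⟨r, c, rfl⟩
  rw [SetLike.mem_coe, RingHom.mem_ker, Matrix.det_fin_two]
  simp [segreMap, Matrix.mvPolynomialX_apply]
  ring

/-- In the kernel of the Segre map, the initial exponent is never alone in its fibre. -/
theorem exists_lt_degree_of_segreMap_eq_zero (ord : MonomialOrder (Fin m × Fin n))
    {f : MvPolynomial (Fin m × Fin n) K} (hf : f ≠ 0) (h : segreMap K m n f = 0) :
    ∃ b, b ≺[ord] ord.degree f ∧ margins (ord.degree f) = margins b := by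
  classical
  by_contra! hcon
  have hsum : segreMap K m n f = ∑ d ∈ f.support, monomial (margins d) (coeff d f) := by
    conv_lhs => rw [← support_sum_monomial_coeff f]
    simp only [map_sum, segreMap_monomial]
  have hmem : ord.degree f ∈ f.support := ord.degree_mem_support hf
  -- By `hcon` no other term of `f` has the margins of the initial one, so its coefficient survives.
  have hcoeff : coeff (margins (ord.degree f)) (segreMap K m n f) = coeff (ord.degree f) f := by
    rw [hsum, coeff_sum, Finset.sum_eq_single (ord.degree f)]
    · simp
    · intro d hd hne
      rw [coeff_monomial, if_neg]
      have hlt : d ≺[ord] ord.degree f :=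
        lt_of_le_of_ne (ord.le_degree hd) fun he => hne (ord.toSyn.injective he)
      exact fun he => hcon d hlt he.symm
    · exact fun h' => absurd hmem h'
  rw [h, coeff_zero] at hcoeff
  exact mem_support_iff.1 hmem hcoeff.symm

end Segre

/-! ### The cycle binomials lie in the ideal -/

section Membership

variable {K : Type*} [Field K] {m n : ℕ}

theorem X_mul_X_sub_mem (i k : Fin m) (j l : Fin n) :
    (X (i, j) * X (k, l) - X (i, l) * X (k, j) : MvPolynomial (Fin m × Fin n) K) ∈
      determinantalIdeal 2 (Matrix.mvPolynomialX (Fin m) (Fin n) K) := by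
  have key : ∀ (i k : Fin m) (j l : Fin n), i < k → j < l →
      (X (i, j) * X (k, l) - X (i, l) * X (k, j) : MvPolynomial (Fin m × Fin n) K) ∈
        determinantalIdeal 2 (Matrix.mvPolynomialX (Fin m) (Fin n) K) := by
    intro i k j l hik hjl
    have hr : StrictMono ![i, k] := by simpa [Fin.strictMono_iff_lt_succ] using hik
    have hc : StrictMono ![j, l] := by simpa [Fin.strictMono_iff_lt_succ] using hjl
    refine Ideal.subset_span ⟨OrderEmbedding.ofStrictMono _ hr, OrderEmbedding.ofStrictMono _ hc, ?_⟩
    rw [Matrix.det_fin_two]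
    simp [Matrix.mvPolynomialX_apply]
  rcases lt_trichotomy i k with hik | rfl | hik
  · rcases lt_trichotomy j l with hjl | rfl | hjl
    · exact key i k j l hik hjl
    · simp
    · rw [← neg_sub]
      exact neg_mem (key i k l j hik hjl)
  · rw [mul_comm, sub_self]
    exact zero_mem _
  · rcases lt_trichotomy j l with hjl | rfl | hjl
    · have := neg_mem (key k i j l hik hjl)
      convert this using 1
      ring
    · simp
    · have := key k i l j hik hjl
      convert this using 1
      ring

/-- Each transposition changes the product by a multiple of a 2-minor (up to sign) or by zero; the
differences telescope. -/
theorem prod_perm_sub_mem {s : ℕ} (I : Fin s → Fin m) (e : Equiv.Perm (Fin s)) :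
    ∀ J : Fin s → Fin n,
    (∏ k, X (I k, J k) - ∏ k, X (I k, J (e k)) : MvPolynomial (Fin m × Fin n) K) ∈
      determinantalIdeal 2 (Matrix.mvPolynomialX (Fin m) (Fin n) K) := by
  induction e using Equiv.Perm.swap_induction_on with
  | one => simp
  | swap_mul e x y hxy ih =>
    intro J
    have hswap : (∏ k, X (I k, J k) - ∏ k, X (I k, J (Equiv.swap x y k)) :
        MvPolynomial (Fin m × Fin n) K) ∈
        determinantalIdeal 2 (Matrix.mvPolynomialX (Fin m) (Fin n) K) := by
      have hy : y ∈ Finset.univ.erase x := by simp [hxy.symm]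
      have hrest : ∏ k ∈ (Finset.univ.erase x).erase y,
          (X (I k, J (Equiv.swap x y k)) : MvPolynomial (Fin m × Fin n) K) =
          ∏ k ∈ (Finset.univ.erase x).erase y, X (I k, J k) := by
        refine Finset.prod_congr rfl fun k hk => ?_
        simp only [Finset.mem_erase] at hk
        rw [Equiv.swap_apply_of_ne_of_ne hk.2.1 hk.1]
      simp only [← Finset.mul_prod_erase _ _ (Finset.mem_univ x), ← Finset.mul_prod_erase _ _ hy,
        hrest, Equiv.swap_apply_left, Equiv.swap_apply_right, ← mul_assoc]
      rw [← sub_mul]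
      exact Ideal.mul_mem_right _ _ (X_mul_X_sub_mem _ _ _ _)
    have := add_mem hswap (ih fun k => J (Equiv.swap x y k))
    rwa [sub_add_sub_cancel] at this

theorem cycleBinomial_mem {s : ℕ} (I : Fin s → Fin m) (J : Fin s → Fin n) :
    cycleBinomial K I J ∈ determinantalIdeal 2 (Matrix.mvPolynomialX (Fin m) (Fin n) K) :=
  prod_perm_sub_mem I (finRotate s) J

theorem cycleBinomial_ne_zero {s : ℕ} (hs : 2 ≤ s) {I : Fin s → Fin m} {J : Fin s → Fin n}
    (hI : Function.Injective I) (hJ : Function.Injective J) : cycleBinomial K I J ≠ 0 := by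
  rw [cycleBinomial_eq, sub_ne_zero]
  intro h
  -- At this entry the first exponent is 1 and the second 0, since the rotation moves index 0.
  have h' := congrArg (fun a => a (I ⟨0, by omega⟩, J ⟨0, by omega⟩))
    (monomial_left_injective (one_ne_zero (α := K)) h)
  simp only [pathExponent_apply, hI.eq_iff, hJ.eq_iff] at h'
  obtain ⟨t, rfl⟩ : ∃ t, s = t + 2 := ⟨s - 2, by omega⟩
  rw [Finset.sum_eq_single ⟨0, by omega⟩ (fun k _ hk => if_neg fun h => hk h.1) (by simp),
    Finset.sum_eq_zero] at h'
  · simp at h'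
  · rintro k -
    refine if_neg ?_
    rintro ⟨rfl, hk⟩
    have := congrArg Fin.val hk
    simp at this

theorem cycleBinomials_finite : (cycleBinomials K m n).Finite := by
  refine ((Set.finite_lt_nat (m + 1)).biUnion fun s _ => Set.finite_range
    fun p : (Fin s → Fin m) × (Fin s → Fin n) => cycleBinomial K p.1 p.2).subset ?_
  rintro _ ⟨s, I, J, -, hI, -, rfl⟩
  have hsm : s ≤ m := by simpa using Fintype.card_le_of_injective I hI
  exact Set.mem_biUnion (Nat.lt_succ_of_le hsm) ⟨(I, J), rfl⟩

end Membership

end DetGroebner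

/-- The binomials `F_{I,J}` form a universal Gröbner basis of the ideal of `2`-minors of the
generic `m × n` matrix over a field `K`. -/
theorem theorem5p3 (K : Type*) [Field K] (m n : ℕ) :
    DetGroebner.IsUniversalGroebnerBasis
      (DetGroebner.cycleBinomials K m n)
      (DetGroebner.determinantalIdeal 2 (Matrix.mvPolynomialX (Fin m) (Fin n) K)) := by
  classical
  intro ord
  have hmem : ∀ g ∈ DetGroebner.cycleBinomials K m n,
      g ∈ DetGroebner.determinantalIdeal 2 (Matrix.mvPolynomialX (Fin m) (Fin n) K) := by
    rintro _ ⟨s, I, J, -, -, -, rfl⟩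
    exact DetGroebner.cycleBinomial_mem I J
  have hne : ∀ g ∈ DetGroebner.cycleBinomials K m n, g ≠ 0 := by
    rintro _ ⟨s, I, J, hs, hI, hJ, rfl⟩
    exact DetGroebner.cycleBinomial_ne_zero hs hI hJ
  refine ⟨DetGroebner.cycleBinomials_finite, hmem, hne, le_antisymm ?_ ?_⟩
  · refine Ideal.span_mono ?_
    rintro _ ⟨g, hg, rfl⟩
    exact ⟨g, hmem g hg, hne g hg, rfl⟩
  · refine Ideal.span_le.2 ?_
    rintro _ ⟨f, hf, hf0, rfl⟩
    obtain ⟨b, hb, hmargins⟩ := DetGroebner.exists_lt_degree_of_segreMap_eq_zero ord hf0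
      (DetGroebner.determinantalIdeal_two_le_ker hf)
    obtain ⟨s, I, J, hs, hI, hJ, hle, hlt⟩ := DetGroebner.exists_cycle_lt ord _ b hmargins hb
    have hdeg : ord.degree (DetGroebner.cycleBinomial K I J) = DetGroebner.pathExponent I J := by
      have h1 : ∀ d : Fin m × Fin n →₀ ℕ,
          ord.degree (MvPolynomial.monomial d (1 : K)) = d := fun d => by
        rw [MonomialOrder.degree_monomial, if_neg one_ne_zero]
      rw [DetGroebner.cycleBinomial_eq, MonomialOrder.degree_sub_of_lt, h1]
      rwa [h1, h1]
    obtain ⟨c, hc⟩ := exists_add_of_le hle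
    have hdvd : DetGroebner.initialMonomial ord f =
        DetGroebner.initialMonomial ord (DetGroebner.cycleBinomial K I J) *
          MvPolynomial.monomial c 1 := by
      rw [DetGroebner.initialMonomial, DetGroebner.initialMonomial, hdeg, hc,
        MvPolynomial.monomial_mul, one_mul]
    rw [SetLike.mem_coe, hdvd]
    exact Ideal.mul_mem_right _ _
      (Ideal.subset_span ⟨_, ⟨s, I, J, hs, hI, hJ, rfl⟩, rfl⟩)
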